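/- Let $\mathcal H$ be a complex Hilbert space and $T\in\mathcal B(\mathcal H)$. Write $T_k=T^{*k}T^k$ for $k\in\mathbb N=\{0,1,2,\dots\}$; $T$ is called half-centered if the operators $T_k$ commute with each other. Let $\mathcal M_{\mathcal E}$ be the smallest closed subspace of $\mathcal H$ that contains $(T\mathcal H)^{\perp}$ and is invariant under every $T_k$, let $P$ be the orthogonal projection of $\mathcal H$ onto $\overline{T\mathcal H}$ (it maps $\mathcal M_{\mathcal E}$ into itself), and let $\mathbb M_T|_{\mathcal M_{\mathcal E}}$ be the algebra of the restrictions to $\mathcal M_{\mathcal E}$ of the elements of the von Neumann algebra $\mathbb M_T$ generated by the $T_k$. Its spectrum $\sigma(\mathbb M_T|_{\mathcal M_{\mathcal E}})$ is the set of its characters (non-zero continuous multiplicative linear functionals); for such a character $\lambda$ write $\lambda(T_k)$ for $\lambda(T_k|_{\mathcal M_{\mathcal E}})$. **Theorem.** Suppose that $T$ is half-centered and injective with $\dim(T\mathcal H)^{\perp}=1$, and let $\mathcal E$ be a unit vector that spans $(T\mathcal H)^{\perp}$. Then the numbers $\tau_k=\langle T_k\mathcal E,\mathcal E\rangle$ are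 real and the following hold. 1. There are a real sequence $(\beta_k)_{k\in\mathbb N}$ and self-adjoint operators $A,C\in\mathcal B(\mathcal M_{\mathcal E})$ with $C=PAP$ such that for every $k\in\mathbb N$ $$T_k|_{\mathcal M_{\mathcal E}}=\tau_kI+\beta_kA,\qquad PT_kP|_{\mathcal M_{\mathcal E}}=\tau_kP+\beta_kC.\tag{$*$}$$ 2. If $\dim\mathcal M_{\mathcal E}\ge 2$, then there are $\lambda,\mu\in\sigma(\mathbb M_T|_{\mathcal M_{\mathcal E}})$ with $\lambda(T_k)\neq\mu(T_k)$ for some $k$. 3. Whenever $\lambda,\mu\in\sigma(\mathbb M_T|_{\mathcal M_{\mathcal E}})$ satisfy $\lambda(T_k)\ne\mu(T_k)$ for some $k$, the numbers $\beta_k:=\lambda(T_k)-\mu(T_k)$ are real, and there are self-adjoint operators $A,C\in\mathcal B(\mathcal M_{\mathcal E})$ with $C=PAP$ such that $(*)$ holds for every $k\in\mathbb N$ with this sequence $(\beta_k)$. -/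

import Mathlib

open scoped InnerProductSpace

noncomputable section

namespace HalfCentered

variable {H : Type*} [NormedAddCommGroup H] [InnerProductSpace ℂ H] [CompleteSpace H]

/-- The operator `T_k = (T^*)^k T^k`. -/
def gram (T : H →L[ℂ] H) (k : ℕ) : H →L[ℂ] H :=
  (ContinuousLinearMap.adjoint T) ^ k * T ^ k

/-- `T` is half-centered: the operators `T_k = (T^*)^k T^k` commute with each other.
(The index `0` is harmless, as `T_0` is the identity.) -/
def IsHalfCentered (T : H →L[ℂ] H) : Prop :=
  ∀ j k : ℕ, Commute (gram T j) (gram T k)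

/-- The space `𝓔 = (T H)ᗮ`. -/
def defect (T : H →L[ℂ] H) : Submodule ℂ H :=
  (LinearMap.range (T : H →ₗ[ℂ] H))ᗮ

/-- The space `M_𝓔`: the smallest closed subspace that contains `𝓔 = (T H)ᗮ` and is
invariant under all the operators `T_k`. -/
def ME (T : H →L[ℂ] H) : Submodule ℂ H :=
  sInf {V : Submodule ℂ H | IsClosed (V : Set H) ∧ defect T ≤ V ∧
    ∀ k : ℕ, ∀ x ∈ V, gram T k x ∈ V}

theorem isClosed_ME (T : H →L[ℂ] H) : IsClosed (ME T : Set H) := by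
  rw [ME, Submodule.coe_sInf]
  exact isClosed_biInter fun V hV => hV.1

instance completeSpace_ME (T : H →L[ℂ] H) : CompleteSpace (ME T) :=
  (isClosed_ME T).completeSpace_coe

theorem defect_le_ME (T : H →L[ℂ] H) : defect T ≤ ME T :=
  le_sInf fun _ hV => hV.2.1

theorem gram_mem_ME (T : H →L[ℂ] H) (k : ℕ) : ∀ x ∈ ME T, gram T k x ∈ ME T := by
  intro x hx
  rw [ME, Submodule.mem_sInf] at hx ⊢
  exact fun V hV => hV.2.2 k x (hx V hV)

/-- The orthogonal projection `P` of `H` onto `H_1`, the closure of `T H`. -/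
def projRange (T : H →L[ℂ] H) : H →L[ℂ] H :=
  (LinearMap.range (T : H →ₗ[ℂ] H)).topologicalClosure.starProjection

theorem projRange_mem_ME (T : H →L[ℂ] H) : ∀ x ∈ ME T, projRange T x ∈ ME T := by
  intro x hx
  have h : x - projRange T x ∈ defect T := by
    have h1 := Submodule.sub_starProjection_mem_orthogonal
      (K := (LinearMap.range (T : H →ₗ[ℂ] H)).topologicalClosure) x
    rwa [Submodule.orthogonal_closure] at h1
  have h2 := (ME T).sub_mem hx (defect_le_ME T h)
  rwa [sub_sub_cancel] at h2

/-- The restriction `B|_V`, as a bounded operator on `V`, of an operator `B` that leaves the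
subspace `V` invariant. -/
def restr (V : Submodule ℂ H) (B : H →L[ℂ] H) (h : ∀ x ∈ V, B x ∈ V) : V →L[ℂ] V :=
  (B.comp V.subtypeL).codRestrict V fun x => h x x.2

/-- `T_k|_{M_𝓔}`. -/
def gramME (T : H →L[ℂ] H) (k : ℕ) : ME T →L[ℂ] ME T :=
  restr (ME T) (gram T k) (gram_mem_ME T k)

/-- `P|_{M_𝓔}`. -/
def projME (T : H →L[ℂ] H) : ME T →L[ℂ] ME T :=
  restr (ME T) (projRange T) (projRange_mem_ME T)

/-- `P T_k P|_{M_𝓔}`. -/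
def compGramME (T : H →L[ℂ] H) (k : ℕ) : ME T →L[ℂ] ME T :=
  restr (ME T) (projRange T * gram T k * projRange T) fun x hx =>
    projRange_mem_ME T _ (gram_mem_ME T k _ (projRange_mem_ME T x hx))

/-- The von Neumann algebra `𝕄_T` generated by the operators `T_k`, `k ∈ ℕ`, that is, the
bicommutant of the set of these (self-adjoint) operators. -/
def vN (T : H →L[ℂ] H) : VonNeumannAlgebra H where
  toStarSubalgebra := StarSubalgebra.centralizer ℂ
    (StarSubalgebra.centralizer ℂ (Set.range (gram T)) : Set (H →L[ℂ] H))
  centralizer_centralizer' := by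
    change Set.centralizer (Set.centralizer (StarSubalgebra.centralizer ℂ
      (StarSubalgebra.centralizer ℂ (Set.range (gram T)) : Set (H →L[ℂ] H)) :
        Set (H →L[ℂ] H))) = (StarSubalgebra.centralizer ℂ
      (StarSubalgebra.centralizer ℂ (Set.range (gram T)) : Set (H →L[ℂ] H)) :
        Set (H →L[ℂ] H))
    rw [StarSubalgebra.coe_centralizer_centralizer, Set.centralizer_centralizer_centralizer]

theorem gram_mem_vN (T : H →L[ℂ] H) (k : ℕ) : gram T k ∈ vN T :=
  StarAlgebra.adjoin_le_centralizer_centralizer ℂ (Set.range (gram T))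
    (StarAlgebra.subset_adjoin ℂ _ ⟨k, rfl⟩)

theorem isSelfAdjoint_gram (T : H →L[ℂ] H) (k : ℕ) : IsSelfAdjoint (gram T k) := by
  rw [gram, ← ContinuousLinearMap.star_eq_adjoint, ← star_pow]
  exact IsSelfAdjoint.star_mul_self (T ^ k)

theorem commute_proj_gram (T : H →L[ℂ] H) (k : ℕ) :
    gram T k * (ME T).starProjection = (ME T).starProjection * gram T k := by
  ext x
  refine (Submodule.eq_starProjection_of_mem_of_inner_eq_zero
    (gram_mem_ME T k _ (Submodule.starProjection_apply_mem _ x)) fun w hw => ?_).symm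
  have hsa : ∀ u v, ⟪gram T k u, v⟫_ℂ = ⟪u, gram T k v⟫_ℂ :=
    (isSelfAdjoint_gram T k).isSymmetric
  change ⟪gram T k x - gram T k ((ME T).starProjection x), w⟫_ℂ = 0
  rw [← map_sub, hsa]
  exact Submodule.starProjection_inner_eq_zero x _ (gram_mem_ME T k w hw)

theorem vN_mem_ME (T : H →L[ℂ] H) {B : H →L[ℂ] H} (hB : B ∈ vN T) :
    ∀ x ∈ ME T, B x ∈ ME T := by
  intro x hx
  have hQ : (ME T).starProjection ∈ StarSubalgebra.centralizer ℂ (Set.range (gram T)) := by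
    rw [StarSubalgebra.mem_centralizer_iff]
    rintro _ ⟨k, rfl⟩
    rw [(isSelfAdjoint_gram T k).star_eq]
    exact ⟨commute_proj_gram T k, commute_proj_gram T k⟩
  have hB' : B ∈ StarSubalgebra.centralizer ℂ
      (StarSubalgebra.centralizer ℂ (Set.range (gram T)) : Set (H →L[ℂ] H)) := hB
  have h := congrArg (fun D : H →L[ℂ] H => D x)
    ((StarSubalgebra.mem_centralizer_iff ℂ).1 hB' _ hQ).1
  have hx' : (ME T).starProjection x = x := Submodule.starProjection_eq_self_iff.2 hx
  simp only [mul_apply_eq_comp, hx'] at h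
  rw [← h]
  exact Submodule.starProjection_apply_mem _ _

/-- The algebra `𝕄_T|M_𝓔` of the restrictions to `M_𝓔` of the elements of `𝕄_T`. -/
def vNME (T : H →L[ℂ] H) : StarSubalgebra ℂ (ME T →L[ℂ] ME T) where
  carrier := {B | ∃ (a : H →L[ℂ] H) (ha : a ∈ vN T), restr (ME T) a (vN_mem_ME T ha) = B}
  mul_mem' := by
    rintro _ _ ⟨a, ha, rfl⟩ ⟨b, hb, rfl⟩
    exact ⟨a * b, mul_mem ha hb, rfl⟩
  add_mem' := by
    rintro _ _ ⟨a, ha, rfl⟩ ⟨b, hb, rfl⟩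
    exact ⟨a + b, add_mem ha hb, rfl⟩
  algebraMap_mem' c := ⟨algebraMap ℂ _ c, (vN T).algebraMap_mem' c, rfl⟩
  star_mem' := by
    rintro _ ⟨a, ha, rfl⟩
    refine ⟨star a, star_mem ha, ?_⟩
    refine (ContinuousLinearMap.eq_adjoint_iff _ _).2 fun x y => ?_
    exact ContinuousLinearMap.adjoint_inner_left a (y : H) (x : H)

/-- `T_k|_{M_𝓔}` as an element of `𝕄_T|M_𝓔`. -/
def gramVN (T : H →L[ℂ] H) (k : ℕ) : vNME T :=
  ⟨gramME T k, gram T k, gram_mem_vN T k, rfl⟩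

/-- The spectrum `σ(𝕄_T|M_𝓔)`: the characters of the algebra `𝕄_T|M_𝓔`. -/
abbrev spec (T : H →L[ℂ] H) : Set (WeakDual ℂ (vNME T)) :=
  WeakDual.characterSpace ℂ (vNME T)

end HalfCentered

end

/-!
Put `v_k = T_k e - τ_k e`, the component of `T_k e` orthogonal to `e`. The heart of the matter is
that all the `v_k` are real multiples of one of them, `v_k = c_k v_j`. The vector `e` is cyclic for
the commuting operators `T_k` restricted to `M_𝓔`, so an operator that commutes with all of them is
determined on `M_𝓔` by its value at `e`; hence `T_k = τ_k + c_k A` on `M_𝓔` with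
`A = T_j - τ_j`, and compressing by `P` gives the second identity with `C = P A P`.

The collinearity (`gram_collinear`) comes from the compressions `P T_k P` commuting with each other.
Formally `T^* T_k P T_j T = T_{k+1} T_1⁻¹ T_{j+1}`, which is symmetric in `j` and `k`. To avoid the
unbounded inverse, `T^* T_k P T_j T` is applied to vectors `T_1 u`: since
`T^* (T_j T T_1 u) = T_{j+1} T_1 u = T_1 T_{j+1} u = T^* (T T_{j+1} u)`, the vectors `T_j T T_1 u`
and `T T_{j+1} u` differ by an element of `ker T^* = ℂ e`. As `T_j` and `T_k` commute as well,
subtracting `P T_j P T_k P = P T_k P T_j P` from `P T_j T_k P = P T_k T_j P` leaves the equality of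
rank-one operators `v_j ⊗ v_k^* = v_k ⊗ v_j^*`, which forces the ratio of `v_k` and `v_j` to exist
and to be real.

For a character `χ` one gets `χ(T_k) = τ_k + c_k χ(A)`. So the differences `χ(T_k) - ψ(T_k)` are
`c_k r` for the fixed number `r = χ(A) - ψ(A)`, and `A` may be replaced by `r⁻¹ A`. Two facts about
characters are needed: they take real values on the `T_k`, and two of them differ at `T_j` when
`T_j` is not scalar on `M_𝓔` (if it is scalar, then so are all `T_k`, and `M_𝓔 = ℂ e`). Both follow
from Gelfand theory once the algebra of restrictions is known to be norm closed
(`isClosed_vNME`). It is the image of the von Neumann algebra under the restriction homomorphism,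
and the image of a star homomorphism between C⋆-algebras is closed (`StarAlgHom.isClosed_range`):
truncating an element by functional calculus lifts every element of the image with control of the
norm.
-/

/-! ### Images of star homomorphisms, and characters of closed star subalgebras -/

open scoped CStarAlgebra in
/-- A self-adjoint `a` can be replaced, without changing `φ a`, by an element of norm at most
`‖φ a‖`: truncate `a` at `±‖φ a‖` by functional calculus, which does nothing on the
spectrum of `φ a`. -/
theorem StarAlgHom.exists_map_eq_norm_le_of_isSelfAdjoint {A B : Type*} [CStarAlgebra A]
    [CStarAlgebra B] (φ : A →⋆ₐ[ℂ] B) {a : A} (ha : IsSelfAdjoint a) :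
    ∃ a' : A, φ a' = φ a ∧ ‖a'‖ ≤ ‖φ a‖ := by
  rcases subsingleton_or_nontrivial B with _ | _
  · exact ⟨0, Subsingleton.elim _ _, by simp⟩
  have hφ : IsSelfAdjoint (φ a) := ha.map φ
  have hcont : Continuous φ := map_continuous φ
  refine ⟨cfc (fun x : ℝ => max (-‖φ a‖) (min x ‖φ a‖)) a, ?_, ?_⟩
  · rw [StarAlgHomClass.map_cfc (S := ℂ) φ (fun x : ℝ => max (-‖φ a‖) (min x ‖φ a‖)) a
      (hφ := hcont)]
    conv_rhs => rw [← cfc_id ℝ (φ a)]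
    refine cfc_congr fun x hx => ?_
    have := abs_le.1 (spectrum.norm_le_norm_of_mem hx)
    simp [min_eq_left this.2, max_eq_right this.1]
  · refine norm_cfc_le (norm_nonneg _) fun x _ => abs_le.2 ⟨le_max_left _ _, max_le ?_ ?_⟩
    · linarith [norm_nonneg (φ a)]
    · exact min_le_right _ _

open scoped ComplexStarModule in
theorem StarAlgHom.exists_map_eq_norm_le {A B : Type*} [CStarAlgebra A]
    [CStarAlgebra B] (φ : A →⋆ₐ[ℂ] B) (a : A) :
    ∃ a' : A, φ a' = φ a ∧ ‖a'‖ ≤ 2 * ‖φ a‖ := by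
  obtain ⟨x, hx, hx'⟩ := φ.exists_map_eq_norm_le_of_isSelfAdjoint (ℜ a).2
  obtain ⟨y, hy, hy'⟩ := φ.exists_map_eq_norm_le_of_isSelfAdjoint (ℑ a).2
  refine ⟨x + Complex.I • y, ?_, ?_⟩
  · rw [map_add, map_smul, hx, hy, ← map_smul, ← map_add, realPart_add_I_smul_imaginaryPart]
  · have h1 : ‖φ (ℜ a : A)‖ ≤ ‖φ a‖ := by
      simpa only [map_realPart] using! realPart.norm_le (φ a)
    have h2 : ‖φ (ℑ a : A)‖ ≤ ‖φ a‖ := by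
      simpa only [map_imaginaryPart] using! imaginaryPart.norm_le (φ a)
    calc ‖x + Complex.I • y‖ ≤ ‖x‖ + ‖Complex.I • y‖ := norm_add_le _ _
      _ = ‖x‖ + ‖y‖ := by simp [norm_smul]
      _ ≤ 2 * ‖φ a‖ := by linarith

/-- The range of a star homomorphism between C⋆-algebras is closed: its elements have lifts of norm
at most twice their own, so that limits of elements of the range can be lifted too. -/
theorem StarAlgHom.isClosed_range {A B : Type*} [CStarAlgebra A] [CStarAlgebra B]
    (φ : A →⋆ₐ[ℂ] B) : IsClosed (φ.range : Set B) := by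
  let f : NormedAddGroupHom A B := (φ : A →+ B).mkNormedAddGroupHom 1 fun a => by
    simpa using NonUnitalStarAlgHom.norm_apply_le φ a
  have hf : f.SurjectiveOnWith f.range 2 := by
    rintro _ ⟨a, rfl⟩
    exact φ.exists_map_eq_norm_le a
  have h := controlled_closure_of_complete two_pos one_pos hf
  refine isClosed_of_closure_subset fun b hb => ?_
  obtain ⟨a, rfl, -⟩ := h b hb
  exact ⟨a, rfl⟩

/-- `StarAlgHom.isClosed_range` for a homomorphism defined on a closed star subalgebra, which is a
C⋆-algebra only through the hypothesis `hS`. -/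
theorem StarSubalgebra.isClosed_range {A B : Type*} [CStarAlgebra A] [CStarAlgebra B]
    (S : StarSubalgebra ℂ A) (hS : IsClosed (S : Set A)) (φ : S →⋆ₐ[ℂ] B) :
    IsClosed (Set.range φ) :=
  have := hS
  φ.isClosed_range

/-- In a closed commutative star subalgebra the characters separate any non-scalar element: the
Gelfand transform of an element on which all characters agree is constant, and the transform is
injective. Characters are given as algebra homomorphisms. -/
theorem StarSubalgebra.exists_algHom_apply_ne {A : Type*} [CStarAlgebra A]
    (S : StarSubalgebra ℂ A) (hS : IsClosed (S : Set A)) (hcomm : ∀ a b : S, a * b = b * a)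
    (a : S) (ha : ∀ c : ℂ, a ≠ algebraMap ℂ S c) :
    ∃ φ ψ : S →ₐ[ℂ] ℂ, Continuous φ ∧ Continuous ψ ∧ φ a ≠ ψ a := by
  have := hS
  let _ : CommCStarAlgebra S := { StarSubalgebra.cstarAlgebra S with mul_comm := hcomm }
  have hinj := (gelfandTransform_isometry S).injective
  by_contra! h
  have h' (χ ψ : WeakDual.characterSpace ℂ S) : χ a = ψ a :=
    h (WeakDual.CharacterSpace.toAlgHom χ) (WeakDual.CharacterSpace.toAlgHom ψ)
      (map_continuous χ) (map_continuous ψ)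
  by_cases hne : Nonempty (WeakDual.characterSpace ℂ S)
  · obtain ⟨ψ⟩ := hne
    refine ha (ψ a) (hinj (ContinuousMap.ext fun χ => ?_))
    have h1 : χ (algebraMap ℂ S (ψ a)) = ψ a := AlgHomClass.commutes χ _
    exact (h' χ ψ).trans h1.symm
  · exact ha 0 (hinj (ContinuousMap.ext fun χ => (hne ⟨χ⟩).elim))

theorem StarSubalgebra.conj_algHom_apply {A : Type*} [CStarAlgebra A]
    (S : StarSubalgebra ℂ A) (hS : IsClosed (S : Set A)) (φ : S →ₐ[ℂ] ℂ) {a : S}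
    (ha : IsSelfAdjoint (a : A)) : (starRingEnd ℂ) (φ a) = φ a := by
  have := hS
  have ha' : IsSelfAdjoint a := Subtype.ext ha
  exact ha'.map φ

theorem IsSelfAdjoint.sub_ofReal_smul_one {A : Type*} [CStarAlgebra A] {a : A}
    (ha : IsSelfAdjoint a) (t : ℝ) : IsSelfAdjoint (a - (t : ℂ) • (1 : A)) :=
  ha.sub (IsSelfAdjoint.smul (Complex.conj_ofReal t) (.one A))

theorem IsSelfAdjoint.ofReal_smul {A : Type*} [CStarAlgebra A] {a : A}
    (ha : IsSelfAdjoint a) (t : ℝ) : IsSelfAdjoint ((t : ℂ) • a) :=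
  IsSelfAdjoint.smul (Complex.conj_ofReal t) ha

theorem IsIdempotentElem.compress_affine {R : Type*} [Ring R] [Algebra ℂ R] {p : R}
    (hp : IsIdempotentElem p) (t b : ℂ) (a : R) :
    p * (t • 1 + b • a) * p = t • p + b • (p * a * p) := by
  rw [mul_add, add_mul, mul_smul_comm, mul_smul_comm, smul_mul_assoc, smul_mul_assoc, mul_one,
    hp.eq]

namespace HalfCentered

open ContinuousLinearMap

section Preliminaries

variable {H : Type*} [NormedAddCommGroup H] [InnerProductSpace ℂ H]

theorem commute_apply {A B : H →L[ℂ] H} (h : Commute A B) (x : H) : A (B x) = B (A x) :=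
  congrArg (fun D : H →L[ℂ] H => D x) h

/-- As `defect T` is a line and `e` is a unit vector in it, `defect T = ℂ e`. -/
theorem exists_smul_eq_of_mem_defect {T : H →L[ℂ] H} (hdim : Module.finrank ℂ (defect T) = 1)
    {e : H} (he : e ∈ defect T) (hnorm : ‖e‖ = 1) {x : H} (hx : x ∈ defect T) :
    x = ⟪e, x⟫_ℂ • e := by
  have hne : (⟨e, he⟩ : defect T) ≠ 0 := fun h => by
    have : e = 0 := congrArg Subtype.val h
    simp [this] at hnorm
  obtain ⟨c, hc⟩ := (finrank_eq_one_iff_of_nonzero' _ hne).1 hdim ⟨x, hx⟩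
  have hc' : c • e = x := congrArg Subtype.val hc
  rw [← hc', inner_smul_right, inner_self_eq_norm_sq_to_K, hnorm]
  simp

end Preliminaries

variable {H : Type*} [NormedAddCommGroup H] [InnerProductSpace ℂ H] [CompleteSpace H]

/-! ### The algebra of restrictions to `M_𝓔` -/

theorem isClosed_vN (T : H →L[ℂ] H) : IsClosed ((vN T).toStarSubalgebra : Set (H →L[ℂ] H)) :=
  Set.isClosed_centralizer _

/-- The restriction to `M_𝓔`, as a star homomorphism from the von Neumann algebra `𝕄_T` to the
bounded operators on `M_𝓔`; its range is `vNME T`. -/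
def restrHom (T : H →L[ℂ] H) : (vN T).toStarSubalgebra →⋆ₐ[ℂ] (ME T →L[ℂ] ME T) where
  toFun a := restr (ME T) a (vN_mem_ME T a.2)
  map_one' := rfl
  map_mul' _ _ := rfl
  map_zero' := rfl
  map_add' _ _ := rfl
  commutes' _ := rfl
  map_star' a := (eq_adjoint_iff _ _).2 fun x y =>
    adjoint_inner_left (a : H →L[ℂ] H) (y : H) (x : H)

theorem range_restrHom (T : H →L[ℂ] H) :
    Set.range (restrHom T) = (vNME T : Set (ME T →L[ℂ] ME T)) := by
  ext B
  constructor
  · rintro ⟨a, rfl⟩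
    exact ⟨a, a.2, rfl⟩
  · rintro ⟨a, ha, rfl⟩
    exact ⟨⟨a, ha⟩, rfl⟩

theorem isClosed_vNME (T : H →L[ℂ] H) : IsClosed (vNME T : Set (ME T →L[ℂ] ME T)) := by
  rw [← range_restrHom]
  exact StarSubalgebra.isClosed_range (B := ME T →L[ℂ] ME T) (vN T).toStarSubalgebra
    (isClosed_vN T) (restrHom T)

theorem vNME_comm {T : H →L[ℂ] H} (hT : IsHalfCentered T) (a b : vNME T) : a * b = b * a := by
  obtain ⟨_, a, ha, rfl⟩ := a
  obtain ⟨_, b, hb, rfl⟩ := b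
  -- the generators lie in their commutant, which therefore contains the bicommutant
  have hb' : b ∈ StarSubalgebra.centralizer ℂ (Set.range (gram T)) := by
    have hb : b ∈ StarSubalgebra.centralizer ℂ
      (StarSubalgebra.centralizer ℂ (Set.range (gram T)) : Set (H →L[ℂ] H)) := hb
    rw [StarSubalgebra.mem_centralizer_iff] at hb ⊢
    rintro _ ⟨k, rfl⟩
    refine hb _ ((StarSubalgebra.mem_centralizer_iff ℂ).2 ?_)
    rintro _ ⟨j, rfl⟩
    rw [(isSelfAdjoint_gram T j).star_eq]
    exact ⟨hT j k, hT j k⟩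
  have ha' : a ∈ StarSubalgebra.centralizer ℂ
      (StarSubalgebra.centralizer ℂ (Set.range (gram T)) : Set (H →L[ℂ] H)) := ha
  have h : a * b = b * a := (((StarSubalgebra.mem_centralizer_iff ℂ).1 ha') b hb').1.symm
  refine Subtype.ext (ContinuousLinearMap.ext fun x => Subtype.ext ?_)
  exact congrArg (fun D : H →L[ℂ] H => D x) h

theorem inner_gram_left (T : H →L[ℂ] H) (k : ℕ) (x y : H) :
    ⟪gram T k x, y⟫_ℂ = ⟪x, gram T k y⟫_ℂ := (isSelfAdjoint_gram T k).isSymmetric x y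

theorem isSelfAdjoint_gramME (T : H →L[ℂ] H) (k : ℕ) : IsSelfAdjoint (gramME T k) :=
  isSelfAdjoint_iff_isSymmetric.2 fun x y => inner_gram_left T k x y

-- `by exact` postpones the unification until the C⋆-algebra structure is fixed
theorem conj_algHom_gramVN (T : H →L[ℂ] H) (φ : vNME T →ₐ[ℂ] ℂ) (k : ℕ) :
    (starRingEnd ℂ) (φ (gramVN T k)) = φ (gramVN T k) :=
  StarSubalgebra.conj_algHom_apply (A := ME T →L[ℂ] ME T) (vNME T) (isClosed_vNME T) φ
    (a := gramVN T k) (by exact isSelfAdjoint_gramME T k)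

theorem exists_mem_spec_eq (T : H →L[ℂ] H) (φ : vNME T →ₐ[ℂ] ℂ) (h : Continuous φ) :
    ∃ χ ∈ spec T, ∀ a, χ a = φ a :=
  ⟨⟨φ.toLinearMap, h⟩,
    ⟨fun h0 => one_ne_zero ((map_one φ).symm.trans (DFunLike.congr_fun h0 1)), map_mul φ⟩,
    fun _ => rfl⟩

theorem exists_algHom_eq_of_mem_spec (T : H →L[ℂ] H) {χ : WeakDual ℂ (vNME T)}
    (hχ : χ ∈ spec T) : ∃ φ : vNME T →ₐ[ℂ] ℂ, ∀ a, χ a = φ a :=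
  ⟨WeakDual.CharacterSpace.toAlgHom ⟨χ, hχ⟩, fun _ => rfl⟩

/-- The characters of `𝕄_T|M_𝓔` separate an element that is not a scalar. -/
theorem exists_mem_spec_apply_ne {T : H →L[ℂ] H} (hT : IsHalfCentered T) (a : vNME T)
    (ha : ∀ c : ℂ, (a : ME T →L[ℂ] ME T) ≠ c • (1 : ME T →L[ℂ] ME T)) :
    ∃ χ ∈ spec T, ∃ ψ ∈ spec T, χ a ≠ ψ a := by
  obtain ⟨φ, φ', hφ, hφ', hne⟩ := StarSubalgebra.exists_algHom_apply_ne
    (A := ME T →L[ℂ] ME T) (vNME T) (isClosed_vNME T) (vNME_comm hT) a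
    fun c hc => ha c (congrArg Subtype.val hc)
  obtain ⟨χ, hχ, h⟩ := exists_mem_spec_eq T φ hφ
  obtain ⟨ψ, hψ, h'⟩ := exists_mem_spec_eq T φ' hφ'
  exact ⟨χ, hχ, ψ, hψ, by rwa [h, h']⟩

/-! ### The vectors `T_k e` modulo `e` -/

theorem gram_succ (T : H →L[ℂ] H) (k : ℕ) : gram T (k + 1) = adjoint T * gram T k * T := by
  simp only [gram, pow_succ' (adjoint T), pow_succ T, mul_assoc]

theorem gram_one (T : H →L[ℂ] H) : gram T 1 = adjoint T * T := by simp [gram]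

theorem mem_defect_iff {T : H →L[ℂ] H} {x : H} : x ∈ defect T ↔ adjoint T x = 0 := by
  rw [defect, orthogonal_range]; exact Iff.rfl

/-- `T_1 = T^* T` inherits injectivity from `T`. -/
theorem gram_one_injective {T : H →L[ℂ] H} (hinj : Function.Injective T) {x : H}
    (h : gram T 1 x = 0) : x = 0 := by
  rw [gram_one] at h
  have h1 : ⟪adjoint T (T x), x⟫_ℂ = 0 := by
    rw [show adjoint T (T x) = 0 from h, inner_zero_left]
  rw [adjoint_inner_left, inner_self_eq_zero] at h1
  exact hinj (by rw [h1, map_zero])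

/-- The left-hand side is `⟪P T_j x, P T_k y⟫` at `x = T T_1 u`, `y = T z`; when `j` and `k` are
interchanged, the right-hand side does not change, since `T_{j+1}` and `T_{k+1}` commute. This is
how the compressions `P T_j P` are seen to commute. -/
theorem inner_gram_gram_sub {T : H →L[ℂ] H} (hT : IsHalfCentered T)
    (hdim : Module.finrank ℂ (defect T) = 1) {e : H} (he : e ∈ defect T) (hnorm : ‖e‖ = 1)
    (j k : ℕ) (u z : H) :
    ⟪gram T j (T (gram T 1 u)), gram T k (T z)⟫_ℂ
      - ⟪gram T j (T (gram T 1 u)), e⟫_ℂ * ⟪e, gram T k (T z)⟫_ℂ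
      = ⟪u, gram T (j + 1) (gram T (k + 1) z)⟫_ℂ := by
  -- `T^*` maps both vectors to `T_{j+1} T_1 u = T_1 T_{j+1} u`
  have hmem : gram T j (T (gram T 1 u)) - T (gram T (j + 1) u) ∈ defect T := by
    have h : gram T (j + 1) (gram T 1 u) = gram T 1 (gram T (j + 1) u) :=
      commute_apply (hT (j + 1) 1) u
    rw [mem_defect_iff, map_sub, sub_eq_zero]
    rw [gram_succ T j, gram_one] at h
    rw [gram_succ T j, gram_one]
    exact h
  have hTe : ∀ x, ⟪e, T x⟫_ℂ = 0 := fun x => by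
    rw [← adjoint_inner_left, mem_defect_iff.1 he, inner_zero_left]
  have h1 := exists_smul_eq_of_mem_defect hdim he hnorm hmem
  rw [inner_sub_right, hTe, sub_zero, sub_eq_iff_eq_add] at h1
  have h2 : ⟪T (gram T (j + 1) u), gram T k (T z)⟫_ℂ
      = ⟪u, gram T (j + 1) (gram T (k + 1) z)⟫_ℂ := by
    have h : gram T (k + 1) z = adjoint T (gram T k (T z)) := by rw [gram_succ]; rfl
    rw [h, ← inner_gram_left T (j + 1), adjoint_inner_right]
  rw [← h2]
  conv_lhs => enter [1]; rw [h1]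
  rw [inner_add_left, inner_smul_left, inner_conj_symm]
  ring

/-- The equality of rank-one operators `v_j ⊗ v_k^* = v_k ⊗ v_j^*`, for `v_k = T_k e - τ_k e`,
evaluated at a vector `T z`. -/
theorem gram_collinear {T : H →L[ℂ] H} (hT : IsHalfCentered T) (hinj : Function.Injective T)
    (hdim : Module.finrank ℂ (defect T) = 1) {e : H} (he : e ∈ defect T) (hnorm : ‖e‖ = 1)
    (j k : ℕ) (z : H) :
    ⟪gram T k e, T z⟫_ℂ • (gram T j e - ⟪e, gram T j e⟫_ℂ • e)
      = ⟪gram T j e, T z⟫_ℂ • (gram T k e - ⟪e, gram T k e⟫_ℂ • e) := by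
  rw [← sub_eq_zero]
  set ξ := ⟪gram T k e, T z⟫_ℂ • (gram T j e - ⟪e, gram T j e⟫_ℂ • e)
      - ⟪gram T j e, T z⟫_ℂ • (gram T k e - ⟪e, gram T k e⟫_ℂ • e) with hξ
  have hee : ⟪e, e⟫_ℂ = 1 := by rw [inner_self_eq_norm_sq_to_K, hnorm]; simp
  have hTe : ∀ x, ⟪T x, e⟫_ℂ = 0 := fun x => by
    rw [← adjoint_inner_right, mem_defect_iff.1 he, inner_zero_right]
  have heξ : ⟪e, ξ⟫_ℂ = 0 := by
    simp only [hξ, inner_sub_right, inner_smul_right, hee]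
    ring
  have key : ∀ u, ⟪T (gram T 1 u), ξ⟫_ℂ = 0 := fun u => by
    have h1 := inner_gram_gram_sub hT hdim he hnorm j k u z
    have h2 := inner_gram_gram_sub hT hdim he hnorm k j u z
    have h3 : gram T (j + 1) (gram T (k + 1) z) = gram T (k + 1) (gram T (j + 1) z) :=
      commute_apply (hT (j + 1) (k + 1)) z
    have h4 : ⟪gram T j (T (gram T 1 u)), gram T k (T z)⟫_ℂ
        = ⟪gram T k (T (gram T 1 u)), gram T j (T z)⟫_ℂ := by
      rw [inner_gram_left T j, inner_gram_left T k, commute_apply (hT j k)]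
    rw [h3, ← h2, h4] at h1
    rw [inner_gram_left T j _ e, inner_gram_left T k _ e, ← inner_gram_left T k e,
      ← inner_gram_left T j e] at h1
    simp only [hξ, inner_sub_right, inner_smul_right, hTe]
    linear_combination -h1
  -- `ξ` is orthogonal to `T T_1 H`, that is, `T_1 T^* ξ = 0`; so `ξ` lies in `ker T^* = ℂ e`
  have h0 : gram T 1 (adjoint T ξ) = 0 := by
    refine ext_inner_left ℂ fun u => ?_
    rw [← inner_gram_left, adjoint_inner_right, key, inner_zero_right]
  have hmem : ξ ∈ defect T := mem_defect_iff.2 (gram_one_injective hinj h0)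
  rw [exists_smul_eq_of_mem_defect hdim he hnorm hmem, heξ, zero_smul]

theorem inner_gram_self_ofReal (T : H →L[ℂ] H) (k : ℕ) (e : H) :
    ((⟪e, gram T k e⟫_ℂ).re : ℂ) = ⟪e, gram T k e⟫_ℂ :=
  (isSelfAdjoint_gram T k).isSymmetric.coe_re_inner_self_apply e

/-- All the vectors `T_k e - τ_k e` are real multiples of a single one of them. -/
theorem exists_real_ratio {T : H →L[ℂ] H} (hT : IsHalfCentered T) (hinj : Function.Injective T)
    (hdim : Module.finrank ℂ (defect T) = 1) {e : H} (he : e ∈ defect T) (hnorm : ‖e‖ = 1) :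
    ∃ (j : ℕ) (c : ℕ → ℝ), ∀ k, gram T k e - ⟪e, gram T k e⟫_ℂ • e
      = (c k : ℂ) • (gram T j e - ⟪e, gram T j e⟫_ℂ • e) := by
  by_cases hall : ∀ k, gram T k e - ⟪e, gram T k e⟫_ℂ • e = 0
  -- if all the vectors vanish, any index `j` does, with zero coefficients
  · exact ⟨0, 0, fun k => by simp [hall k]⟩
  push Not at hall
  obtain ⟨j, hj⟩ := hall
  refine ⟨j, ?_⟩
  suffices h : ∀ k, ∃ r : ℝ, gram T k e - ⟪e, gram T k e⟫_ℂ • e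
      = (r : ℂ) • (gram T j e - ⟪e, gram T j e⟫_ℂ • e) by
    choose c hc using h
    exact ⟨c, hc⟩
  intro k
  set v := fun k => gram T k e - ⟪e, gram T k e⟫_ℂ • e with hv
  have hee : ⟪e, e⟫_ℂ = 1 := by rw [inner_self_eq_norm_sq_to_K, hnorm]; simp
  have hev : ∀ k, ⟪e, v k⟫_ℂ = 0 := fun k => by
    simp only [hv, inner_sub_right, inner_smul_right, hee]
    ring
  have hTe : ∀ x, ⟪e, T x⟫_ℂ = 0 := fun x => by
    rw [← adjoint_inner_left, mem_defect_iff.1 he, inner_zero_left]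
  have hvT : ∀ k z, ⟪gram T k e, T z⟫_ℂ = ⟪v k, T z⟫_ℂ := fun k z => by
    simp only [hv, inner_sub_left, inner_smul_left, hTe]
    ring
  -- a vector orthogonal to both `T H` and `e` vanishes
  obtain ⟨z, hz⟩ : ∃ z, ⟪v j, T z⟫_ℂ ≠ 0 := by
    by_contra! h
    refine hj ?_
    have hmem : v j ∈ defect T := mem_defect_iff.2 <| ext_inner_right ℂ fun z => by
      rw [adjoint_inner_left, h, inner_zero_left]
    change v j = 0
    rw [exists_smul_eq_of_mem_defect hdim he hnorm hmem, hev, zero_smul]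
  have h1 : ⟪v k, T z⟫_ℂ • v j = ⟪v j, T z⟫_ℂ • v k := by
    rw [← hvT, ← hvT]; exact gram_collinear hT hinj hdim he hnorm j k z
  obtain ⟨d, hd⟩ : ∃ d : ℂ, v k = d • v j :=
    ⟨(⟪v j, T z⟫_ℂ)⁻¹ * ⟪v k, T z⟫_ℂ, by rw [mul_smul, h1, inv_smul_smul₀ hz]⟩
  rw [hd, inner_smul_left, smul_smul] at h1
  have h2 := smul_left_injective ℂ hj h1
  -- the collinearity relation now reads `conj d * ⟪v_j, T z⟫ = d * ⟪v_j, T z⟫`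
  have h3 : (starRingEnd ℂ) d = d := mul_right_cancel₀ hz (h2.trans (mul_comm _ _))
  obtain ⟨r, rfl⟩ := Complex.conj_eq_iff_real.1 h3
  exact ⟨r, hd⟩

/-- Minimality of `M_𝓔`, which is generated by the single vector `e`. -/
theorem ME_le_of_mem {T : H →L[ℂ] H} (hdim : Module.finrank ℂ (defect T) = 1)
    {e : H} (he : e ∈ defect T) (hnorm : ‖e‖ = 1) {V : Submodule ℂ H}
    (hV : IsClosed (V : Set H)) (heV : e ∈ V) (hinv : ∀ k, ∀ x ∈ V, gram T k x ∈ V) :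
    ME T ≤ V := by
  refine sInf_le ⟨hV, fun x hx => ?_, hinv⟩
  rw [exists_smul_eq_of_mem_defect hdim he hnorm hx]
  exact V.smul_mem _ heV

/-- `e` is separating: an operator that commutes with every `T_k` and kills `e` vanishes on
`M_𝓔`. -/
theorem eq_zero_on_ME {T : H →L[ℂ] H}
    (hdim : Module.finrank ℂ (defect T) = 1) {e : H} (he : e ∈ defect T) (hnorm : ‖e‖ = 1)
    {D : H →L[ℂ] H} (hD : ∀ k, Commute D (gram T k)) (h0 : D e = 0) {x : H} (hx : x ∈ ME T) :
    D x = 0 := by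
  refine ME_le_of_mem (V := LinearMap.ker (D : H →ₗ[ℂ] H)) hdim he hnorm
    (ContinuousLinearMap.isClosed_ker D) h0 (fun k y hy => ?_) hx
  have hy : D y = 0 := hy
  have h : D (gram T k y) = gram T k (D y) := commute_apply (hD k) y
  change D (gram T k y) = 0
  rw [h, hy, map_zero]

/-! ### The operators `T_k` on `M_𝓔` -/

/-- On `M_𝓔` every `T_k` is a real affine function of a single `T_j`. -/
theorem gramVN_eq_affine {T : H →L[ℂ] H} (hT : IsHalfCentered T) (hinj : Function.Injective T)
    (hdim : Module.finrank ℂ (defect T) = 1) {e : H} (he : e ∈ defect T) (hnorm : ‖e‖ = 1) :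
    ∃ (j : ℕ) (c : ℕ → ℝ), ∀ k, gramVN T k = ⟪e, gram T k e⟫_ℂ • (1 : vNME T)
      + (c k : ℂ) • (gramVN T j - ⟪e, gram T j e⟫_ℂ • (1 : vNME T)) := by
  obtain ⟨j, c, h⟩ := exists_real_ratio hT hinj hdim he hnorm
  refine ⟨j, c, fun k => Subtype.ext (ContinuousLinearMap.ext fun x => Subtype.ext ?_)⟩
  have hcomm (i l : ℕ) (s : ℂ) : Commute (gram T i - s • 1) (gram T l) :=
    (hT i l).sub_left ((Commute.one_left _).smul_left s)
  have h0 := eq_zero_on_ME hdim he hnorm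
    (D := (gram T k - ⟪e, gram T k e⟫_ℂ • 1) - (c k : ℂ) • (gram T j - ⟪e, gram T j e⟫_ℂ • 1))
    (fun l => (hcomm k l _).sub_left ((hcomm j l _).smul_left _))
    (sub_eq_zero.2 (h k)) x.2
  have h1 : (gram T k x - ⟪e, gram T k e⟫_ℂ • (x : H))
      - (c k : ℂ) • (gram T j x - ⟪e, gram T j e⟫_ℂ • (x : H)) = 0 := h0
  change gram T k x = ⟪e, gram T k e⟫_ℂ • (x : H)
    + (c k : ℂ) • (gram T j x - ⟪e, gram T j e⟫_ℂ • (x : H))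
  rw [← sub_eq_zero, ← h1]
  abel

theorem rank_ME_le_one {T : H →L[ℂ] H}
    (hdim : Module.finrank ℂ (defect T) = 1) {e : H} (he : e ∈ defect T) (hnorm : ‖e‖ = 1)
    (h : ∀ k, ∃ s : ℂ, gram T k e = s • e) : Module.rank ℂ (ME T) ≤ 1 := by
  have hle : ME T ≤ ℂ ∙ e := by
    refine ME_le_of_mem hdim he hnorm (Submodule.closed_of_finiteDimensional _)
      (Submodule.mem_span_singleton_self e) fun k x hx => ?_
    obtain ⟨a, rfl⟩ := Submodule.mem_span_singleton.1 hx
    obtain ⟨s, hs⟩ := h k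
    rw [map_smul, hs]
    exact Submodule.smul_mem _ _ (Submodule.smul_mem _ _ (Submodule.mem_span_singleton_self e))
  refine (Submodule.rank_mono hle).trans ((rank_span_le _).trans ?_)
  simp

theorem isIdempotentElem_projME (T : H →L[ℂ] H) : IsIdempotentElem (projME T) :=
  ContinuousLinearMap.ext fun _ => Subtype.ext <|
    Submodule.starProjection_eq_self_iff.2 (Submodule.starProjection_apply_mem _ _)

theorem isSelfAdjoint_projME (T : H →L[ℂ] H) : IsSelfAdjoint (projME T) :=
  isSelfAdjoint_iff_isSymmetric.2 fun x y =>
    Submodule.inner_starProjection_left_eq_right _ (x : H) (y : H)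

theorem compGramME_eq (T : H →L[ℂ] H) (k : ℕ) :
    compGramME T k = projME T * gramME T k * projME T := rfl

/-- A formula `T_k = τ_k + β_k A` on `M_𝓔` yields the one for the compressions, with `C = P A P`. -/
theorem affine_conclusion (T : H →L[ℂ] H) {τ β : ℕ → ℝ} {A : ME T →L[ℂ] ME T}
    (hA : IsSelfAdjoint A)
    (h : ∀ k, gramME T k = (τ k : ℂ) • (1 : ME T →L[ℂ] ME T) + (β k : ℂ) • A) :
    ∃ A C : ME T →L[ℂ] ME T, IsSelfAdjoint A ∧ IsSelfAdjoint C ∧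
      C = projME T * A * projME T ∧
      ∀ k, gramME T k = (τ k : ℂ) • (1 : ME T →L[ℂ] ME T) + (β k : ℂ) • A ∧
        compGramME T k = (τ k : ℂ) • projME T + (β k : ℂ) • C := by
  refine ⟨A, _, hA, ?_, rfl, fun k => ⟨h k, ?_⟩⟩
  · have h1 := hA.conjugate (projME T)
    rwa [(isSelfAdjoint_projME T).star_eq] at h1
  · rw [compGramME_eq, h k]
    exact (isIdempotentElem_projME T).compress_affine _ _ A

end HalfCentered

open HalfCentered in
theorem mainTheorem4 {H : Type*} [NormedAddCommGroup H] [InnerProductSpace ℂ H]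
    [CompleteSpace H] (T : H →L[ℂ] H) (hT : IsHalfCentered T) (hinj : Function.Injective T)
    (hdim : Module.finrank ℂ (defect T) = 1)
    (e : H) (he : e ∈ defect T) (hnorm : ‖e‖ = 1) :
    ∃ τ : ℕ → ℝ, (∀ k, (τ k : ℂ) = ⟪e, gram T k e⟫_ℂ) ∧
      (∃ (β : ℕ → ℝ) (A C : ME T →L[ℂ] ME T), IsSelfAdjoint A ∧ IsSelfAdjoint C ∧
        C = projME T * A * projME T ∧
        ∀ k, gramME T k = (τ k : ℂ) • (1 : ME T →L[ℂ] ME T) + (β k : ℂ) • A ∧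
          compGramME T k = (τ k : ℂ) • projME T + (β k : ℂ) • C) ∧
      (2 ≤ Module.rank ℂ (ME T) →
        ∃ χ ∈ spec T, ∃ ψ ∈ spec T, ∃ k, χ (gramVN T k) ≠ ψ (gramVN T k)) ∧
      (∀ χ ∈ spec T, ∀ ψ ∈ spec T, (∃ k, χ (gramVN T k) ≠ ψ (gramVN T k)) →
        ∃ β : ℕ → ℝ, (∀ k, (β k : ℂ) = χ (gramVN T k) - ψ (gramVN T k)) ∧
        ∃ A C : ME T →L[ℂ] ME T, IsSelfAdjoint A ∧ IsSelfAdjoint C ∧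
          C = projME T * A * projME T ∧
          ∀ k, gramME T k = (τ k : ℂ) • (1 : ME T →L[ℂ] ME T) + (β k : ℂ) • A ∧
            compGramME T k = (τ k : ℂ) • projME T + (β k : ℂ) • C) := by
  obtain ⟨j, c, hc⟩ := gramVN_eq_affine hT hinj hdim he hnorm
  set τ : ℕ → ℝ := fun k => (⟪e, gram T k e⟫_ℂ).re
  have hτ : ∀ k, (τ k : ℂ) = ⟪e, gram T k e⟫_ℂ := fun k => inner_gram_self_ofReal T k e
  simp only [← hτ] at hc
  have hc' : ∀ k, gramME T k = (τ k : ℂ) • (1 : ME T →L[ℂ] ME T)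
      + (c k : ℂ) • (gramME T j - (τ j : ℂ) • (1 : ME T →L[ℂ] ME T)) :=
    fun k => congrArg Subtype.val (hc k)
  have hA : IsSelfAdjoint (gramME T j - (τ j : ℂ) • (1 : ME T →L[ℂ] ME T)) :=
    IsSelfAdjoint.sub_ofReal_smul_one (A := ME T →L[ℂ] ME T)
      (by exact isSelfAdjoint_gramME T j) (τ j)
  refine ⟨τ, hτ, ⟨c, affine_conclusion T hA hc'⟩, fun hrank => ?_, fun χ hχ ψ hψ hne => ?_⟩
  · by_contra! hall
    obtain ⟨s, hs'⟩ : ∃ s : ℂ, gramME T j = s • (1 : ME T →L[ℂ] ME T) := by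
      by_contra! h
      obtain ⟨χ, hχ, ψ, hψ, hne⟩ := exists_mem_spec_apply_ne hT (gramVN T j) h
      exact hne (hall χ hχ ψ hψ j)
    refine absurd (hrank.trans (rank_ME_le_one hdim he hnorm fun k =>
      ⟨(τ k : ℂ) + (c k : ℂ) * (s - (τ j : ℂ)), ?_⟩)) (by norm_num)
    have h1 := hc' k
    rw [hs'] at h1
    have h2 : gram T k e = (τ k : ℂ) • e + (c k : ℂ) • (s • e - (τ j : ℂ) • e) :=
      congrArg (fun B : ME T →L[ℂ] ME T => (B ⟨e, defect_le_ME T he⟩ : H)) h1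
    rw [h2, ← sub_smul, smul_smul, ← add_smul]
  · obtain ⟨φ, hφ⟩ := exists_algHom_eq_of_mem_spec T hχ
    obtain ⟨φ', hφ'⟩ := exists_algHom_eq_of_mem_spec T hψ
    simp only [hφ, hφ'] at hne ⊢
    have hdiff : ∀ k, φ (gramVN T k) - φ' (gramVN T k)
        = (c k : ℂ) * (φ (gramVN T j) - φ' (gramVN T j)) := fun k => by
      rw [hc k]
      simp only [map_add, map_sub, map_smul, map_one, smul_eq_mul]
      ring
    -- `r = χ(T_j) - ψ(T_j)`, so that the new `A` is the old one divided by `r`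
    obtain ⟨r, hr⟩ := Complex.conj_eq_iff_real.1 <|
      show (starRingEnd ℂ) (φ (gramVN T j) - φ' (gramVN T j)) = _ by
        rw [map_sub, conj_algHom_gramVN, conj_algHom_gramVN]
    have hr0 : (r : ℂ) ≠ 0 := fun h => by
      obtain ⟨k, hk⟩ := hne
      refine hk (sub_eq_zero.1 ?_)
      rw [hdiff, hr, h, mul_zero]
    refine ⟨fun k => c k * r, fun k => ?_, affine_conclusion T (A := ((r⁻¹ : ℝ) : ℂ) • _)
      (IsSelfAdjoint.ofReal_smul (A := ME T →L[ℂ] ME T) (by exact hA) r⁻¹) fun k => ?_⟩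
    · rw [hdiff, hr, Complex.ofReal_mul]
    · rw [smul_smul, Complex.ofReal_mul, Complex.ofReal_inv, mul_assoc, mul_inv_cancel₀ hr0,
        mul_one]
      exact hc' k
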